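/- **Uniformly strict folk theorem.** *Model.* Players $N=\{1,\dots,n\}$ have finite action sets $A_i$, finite private signal sets $S_i$ and finite public message sets $M_i$; write $A=\prod_i A_i$, $S=\prod_i S_i$, $M=\prod_i M_i$. Stage payoffs are $g:A\to\mathbb R^n$, and $p(\cdot\mid a)\in\Delta(S)$ is the signal distribution given $a\in A$, whose marginal on each $S_i$ has full support. Payoffs are normalized so that $\min_{a_{-i}}\max_{a_i}g_i(a_i,a_{-i})=0$ for every $i$. Let $R_i$ be the set of maps $\rho_i:S_i\to M_i$, $R=\prod_iR_i$, and $\tilde p(m\mid a,\rho)=\sum_{s:\,\rho_i(s_i)=m_i\,\forall i}p(s\mid a)$. Let $V(G)=\mathrm{co}\{g(a):a\in A\}$, $V^*(G)=\{v\in V(G):v\ge 0\}$, and let $A(G)$ be the set of $a\in A$ for which $g(a)$ is an extreme point of $V(G)$. *Equilibrium.* In each period players choose actions, observe private signals and send public messages. A public history is a finite sequence $h$ of message profiles. A pure public strategy of player $i$ assigns to each $h$ an action $\sigma_i^a(h)$ and to each $h$ and own current action $a_i$ a message strategy in $R_i$; let $\sigma(h)\in A\times R$ be the profile of prescribed actions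 and on-path message strategies at $h$. For $\delta\in(0,1)$ let $w^\sigma(h)\in\mathbb R^n$ be the $\delta$-discounted average continuation payoff profile after $h$. A one-shot deviation $(a_i',\rho_i')\in A_i\times R_i$ at $h$ is nontrivial if $a_i'\ne\sigma^a_i(h)$ or if it changes the distribution of $w^\sigma(h,\cdot)$. The profile $\sigma$ is an $\eta$-USPPE if for all $h$, all $i$ and all nontrivial $(a_i',\rho_i')$ at $h$, $$g_i(\sigma^a(h))+\tfrac{\delta}{1-\delta}\sum_{m\in M}w_i^\sigma(h,m)\,\tilde p(m\mid\sigma(h))-\eta\ \ge\ g_i(a_i',\sigma^a_{-i}(h))+\tfrac{\delta}{1-\delta}\sum_{m\in M}w_i^\sigma(h,m)\,\tilde p(m\mid(a_i',\rho_i'),\sigma_{-i}(h)).$$ $E^\eta(\delta)$ is the set of payoff profiles $w^\sigma(\varnothing)$ of $\eta$-USPPE $\sigma$. *Conditions.* For $a\in A$, $\rho\in R$ let $\Phi_i(a,\rho)=\Delta((A_i\times R_i)\setminus\{(a_i,\rho_i)\})$. For $\phi_i\in\Phi_i(a,\rho)$ let $\alpha_i(\phi_i)$ be its marginal on $A_i$,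 let $\tilde p(\cdot\mid\phi_i,(a_{-i},\rho_{-i}))$ be the induced message distribution, and put $L_i(\phi_i)=g_i(a)-g_i(\alpha_i(\phi_i),a_{-i})$. - $\eta$-detectability at $a$ with $\rho$: for every $i$ and $\phi_i\in\Phi_i(a,\rho)$, if $\tilde p(\cdot\mid\phi_i,(a_{-i},\rho_{-i}))=\tilde p(\cdot\mid a,\rho)$ then $L_i(\phi_i)\ge\eta$. - $\eta$-identifiability at $a$ with $\rho$: for all $i\ne j$, $\phi_i\in\Phi_i(a,\rho)$ and $\phi_j\in\Phi_j(a,\rho)$, if $\tilde p(\cdot\mid\phi_i,(a_{-i},\rho_{-i}))-\tilde p(\cdot\mid a,\rho)$ and $\tilde p(\cdot\mid\phi_j,(a_{-j},\rho_{-j}))-\tilde p(\cdot\mid a,\rho)$ are not linearly independent, then $\min\{L_i(\phi_i),L_j(\phi_j)\}\ge\eta$. - $\eta^*$-detectability with respect to $i$ at $a$: there is $\rho\in R$ such that for every $j\ne i$ and $\phi_j\in\Phi_j(a,\rho)$, if $\tilde p(\cdot\mid\phi_j,(a_{-j},\rho_{-j}))$ and $\tilde p(\cdot\mid a,\rho)$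 have the same marginal on $M_{-i}$, then $L_j(\phi_j)\ge\eta$. - $\eta$-best response property for $\{\overline a^i,\underline a^i\}_{i\in N}\subset A$: for every $i$, $g_i(\overline a^i)=\max_a g_i(a)$ and $g_i(\overline a^i)-g_i(a_i',\overline a^i_{-i})\ge\eta$ for all $a_i'\neq\overline a^i_i$; and $g_i(\underline a^i)=\min_{a_{-i}}\max_{a_i}g_i(a)$ and $g_i(\underline a^i)-g_i(a_i',\underline a^i_{-i})\ge\eta$ for all $a_i'\ne\underline a^i_i$. A nonempty compact convex subset of $\mathbb R^n$ is *smooth* if it has a unique supporting hyperplane at each of its boundary points. **Theorem.** Let $\eta\ge 0$. Suppose that $\mathrm{int}\,V^*(G)\neq\emptyset$, that $G$ satisfies the $\eta$-best response property for $\{\overline a^i,\underline a^i\}_{i\in N}$, that for each $a\in A(G)$ there is $\rho^a\in R$ such that both $\eta$-detectability and $\eta$-identifiability hold at $a$ with $\rho^a$, and that for every $i$, $\eta^*$-detectability with respect to $i$ holds at $\overline a^i$ and at $\underline a^i$. Then for every $\varepsilon>0$ there are a smooth compact convex set $W\subseteq\mathrm{int}\,V^*(G)$, whose Hausdorff distance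 from $V^*(G)$ is at most $\varepsilon$, and $\underline\delta\in(0,1)$ such that $W\subseteq E^\eta(\delta)$ for all $\delta\in(\underline\delta,1)$. -/

import Mathlib

open scoped RealInnerProductSpace

noncomputable section

namespace RepeatedGame

/-- The pure-strategy minmax payoff `min_{a_{-i}} max_{a_i} g_i(a_i, a_{-i})`.  The expression under
the infimum depends on the profile `a` through `a_{-i}` only; both ranges are finite. -/
def pureMinmax {n : ℕ} {A : Fin n → Type*}
    (g : (∀ i, A i) → EuclideanSpace ℝ (Fin n)) (i : Fin n) : ℝ :=
  ⨅ a : (∀ j, A j), ⨆ x : A i, g (Function.update a i x) i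

/-- A private monitoring game `(G, p)` with players `Fin n`, finite action sets `A i`, finite sets
`S i` of private signals and finite sets `M i` of public messages. -/
structure PrivateMonitoringGame {n : ℕ} (A S M : Fin n → Type*)
    [∀ i, Fintype (A i)] [∀ i, Fintype (S i)] [∀ i, Fintype (M i)]
    [∀ i, DecidableEq (S i)] [∀ i, DecidableEq (M i)] where
  /-- stage payoffs -/
  g : (∀ i, A i) → EuclideanSpace ℝ (Fin n)
  /-- `p a s` is the probability of the signal profile `s` given the action profile `a` -/
  p : (∀ i, A i) → (∀ i, S i) → ℝ
  p_mem : ∀ a, p a ∈ stdSimplex ℝ (∀ i, S i)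
  /-- the marginal distribution of each player's signal has full support -/
  marginal_pos : ∀ (a : ∀ i, A i) (i : Fin n) (t : S i), 0 < ∑ s with s i = t, p a s
  /-- payoffs are normalized so that pure minmax payoffs vanish -/
  minmax_eq_zero : ∀ i, pureMinmax g i = 0

/-- A pure public strategy of player `i`.  A public history is the list of the message profiles sent
so far, the oldest one first; the current message strategy may also depend on the own current
action. -/
structure PublicStrategy {n : ℕ} (A S M : Fin n → Type*) (i : Fin n) where
  act : List (∀ j, M j) → A i
  msg : List (∀ j, M j) → A i → (S i → M i)

/-- The action profile prescribed after a public history. -/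
def actAt {n : ℕ} {A S M : Fin n → Type*} (σ : ∀ i, PublicStrategy A S M i)
    (h : List (∀ j, M j)) : ∀ i, A i :=
  fun i => (σ i).act h

/-- The profile of on-path message strategies prescribed after a public history. -/
def msgAt {n : ℕ} {A S M : Fin n → Type*} (σ : ∀ i, PublicStrategy A S M i)
    (h : List (∀ j, M j)) : ∀ i, S i → M i :=
  fun i => (σ i).msg h ((σ i).act h)

/-- `H` is a supporting hyperplane of `W` at `v`. -/
def IsSupportingHyperplane {n : ℕ} (W H : Set (EuclideanSpace ℝ (Fin n)))
    (v : EuclideanSpace ℝ (Fin n)) : Prop :=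
  ∃ l : EuclideanSpace ℝ (Fin n), l ≠ 0 ∧ H = {x | ⟪l, x⟫ = ⟪l, v⟫} ∧ ∀ x ∈ W, ⟪l, x⟫ ≤ ⟪l, v⟫

/-- A smooth compact convex set: nonempty, compact, convex, with a unique supporting hyperplane at
every boundary point. -/
def IsSmoothCompactConvex {n : ℕ} (W : Set (EuclideanSpace ℝ (Fin n))) : Prop :=
  W.Nonempty ∧ IsCompact W ∧ Convex ℝ W ∧
    ∀ v ∈ frontier W, ∃! H : Set (EuclideanSpace ℝ (Fin n)), IsSupportingHyperplane W H v

open Classical in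
/-- The distribution of `w` on `EuclideanSpace ℝ (Fin n)` when the message profile has
distribution `q`: the probability that `w` takes the value `y`. -/
def valueDist {n : ℕ} {N : Type*} [Fintype N] (q : N → ℝ) (w : N → EuclideanSpace ℝ (Fin n))
    (y : EuclideanSpace ℝ (Fin n)) : ℝ :=
  ∑ m with w m = y, q m

namespace PrivateMonitoringGame

variable {n : ℕ} {A S M : Fin n → Type*}
  [∀ i, Fintype (A i)] [∀ i, Fintype (S i)] [∀ i, Fintype (M i)]
  [∀ i, DecidableEq (S i)] [∀ i, DecidableEq (M i)]

/-- The set `V(G)` of feasible payoff profiles. -/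
def feasible (G : PrivateMonitoringGame A S M) : Set (EuclideanSpace ℝ (Fin n)) :=
  convexHull ℝ (Set.range G.g)

/-- The set `V*(G)` of feasible and individually rational payoff profiles. -/
def feasibleIR (G : PrivateMonitoringGame A S M) : Set (EuclideanSpace ℝ (Fin n)) :=
  {v | v ∈ G.feasible ∧ ∀ i, 0 ≤ v i}

/-- The set `A(G)` of action profiles that generate an extreme point of `V(G)`. -/
def extremeProfiles (G : PrivateMonitoringGame A S M) : Set (∀ i, A i) :=
  {a | G.g a ∈ G.feasible.extremePoints ℝ}

/-- The distribution `p̃(· | (a, ρ))` of the public message profile. -/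
def msgDist (G : PrivateMonitoringGame A S M) (a : ∀ i, A i) (ρ : ∀ i, S i → M i)
    (m : ∀ i, M i) : ℝ :=
  ∑ s with ∀ i, ρ i (s i) = m i, G.p a s

/-- The distribution of the public message profile when player `i` unilaterally deviates from
`(a, ρ)` to `d = (a_i', ρ_i')`. -/
def devDist (G : PrivateMonitoringGame A S M) (a : ∀ i, A i) (ρ : ∀ i, S i → M i)
    (i : Fin n) (d : A i × (S i → M i)) : (∀ i, M i) → ℝ :=
  G.msgDist (Function.update a i d.1) (Function.update ρ i d.2)

/-- The distribution of the public message profile when player `i` unilaterally deviates from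
`(a, ρ)` to the mixed strategy `φ`. -/
def mixedDevDist (G : PrivateMonitoringGame A S M) (a : ∀ i, A i) (ρ : ∀ i, S i → M i)
    (i : Fin n) (φ : A i × (S i → M i) → ℝ) (m : ∀ i, M i) : ℝ :=
  ∑ d, G.devDist a ρ i d m * φ d

/-- Player `i`'s stage payoff `g_i(α_i(φ), a_{-i})` under the marginal `α_i(φ)` of the mixed
strategy `φ` on `A i`. -/
def mixedDevPayoff (G : PrivateMonitoringGame A S M) (a : ∀ i, A i)
    (i : Fin n) (φ : A i × (S i → M i) → ℝ) : ℝ :=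
  ∑ x : A i, (∑ r : S i → M i, φ (x, r)) * G.g (Function.update a i x) i

/-- The mixed strategies of player `i` over `(A i × R i) \ {(a i, ρ i)}`. -/
def mixedDeviations (a : ∀ i, A i) (ρ : ∀ i, S i → M i) (i : Fin n) :
    Set (A i × (S i → M i) → ℝ) :=
  {φ | φ ∈ stdSimplex ℝ (A i × (S i → M i)) ∧ φ (a i, ρ i) = 0}

/-- The marginal on the messages of the players other than `i`. -/
def marginalExcept (i : Fin n) (q : (∀ k, M k) → ℝ) (m : ∀ k : {k : Fin n // k ≠ i}, M k) : ℝ :=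
  ∑ m' with ∀ k : {k : Fin n // k ≠ i}, m' k = m k, q m'

/-- The requirement of `η`-detectability at `a` with the message strategy profile `ρ`. -/
def DetectableWith (G : PrivateMonitoringGame A S M) (η : ℝ) (a : ∀ i, A i)
    (ρ : ∀ i, S i → M i) : Prop :=
  ∀ i, ∀ φ ∈ mixedDeviations a ρ i,
    G.mixedDevDist a ρ i φ = G.msgDist a ρ → η ≤ G.g a i - G.mixedDevPayoff a i φ

/-- The requirement of `η`-identifiability at `a` with the message strategy profile `ρ`. -/
def IdentifiableWith (G : PrivateMonitoringGame A S M) (η : ℝ) (a : ∀ i, A i)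
    (ρ : ∀ i, S i → M i) : Prop :=
  ∀ i j, i ≠ j → ∀ φ ∈ mixedDeviations a ρ i, ∀ ψ ∈ mixedDeviations a ρ j,
    ¬ LinearIndependent ℝ
        ![G.mixedDevDist a ρ i φ - G.msgDist a ρ, G.mixedDevDist a ρ j ψ - G.msgDist a ρ] →
      η ≤ min (G.g a i - G.mixedDevPayoff a i φ) (G.g a j - G.mixedDevPayoff a j ψ)

/-- `η*`-detectability with respect to player `i` at `a`. -/
def StarDetectable (G : PrivateMonitoringGame A S M) (η : ℝ) (i : Fin n) (a : ∀ i, A i) : Prop :=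
  ∃ ρ : ∀ i, S i → M i, ∀ j, j ≠ i → ∀ φ ∈ mixedDeviations a ρ j,
    marginalExcept i (G.mixedDevDist a ρ j φ) = marginalExcept i (G.msgDist a ρ) →
      η ≤ G.g a j - G.mixedDevPayoff a j φ

/-- The `η`-best response property for the profiles `best i` and `worst i`, `i` a player. -/
def BestResponseProperty (G : PrivateMonitoringGame A S M) (η : ℝ)
    (best worst : Fin n → ∀ i, A i) : Prop :=
  ∀ i,
    ((∀ a, G.g a i ≤ G.g (best i) i) ∧
      ∀ x : A i, x ≠ best i i → η ≤ G.g (best i) i - G.g (Function.update (best i) i x) i) ∧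
    (G.g (worst i) i = pureMinmax G.g i ∧
      ∀ x : A i, x ≠ worst i i → η ≤ G.g (worst i) i - G.g (Function.update (worst i) i x) i)

/-- The probability that, after the public history `h`, the next message profiles are those of the
given list, if `σ` is played. -/
def pathProb (G : PrivateMonitoringGame A S M) (σ : ∀ i, PublicStrategy A S M i) :
    List (∀ i, M i) → List (∀ i, M i) → ℝ
  | _, [] => 1
  | h, m :: l => G.msgDist (actAt σ h) (msgAt σ h) m * pathProb G σ (h ++ [m]) l

/-- The expected stage payoff profile `t` periods after the public history `h`. -/
def expectedStagePayoff (G : PrivateMonitoringGame A S M) (σ : ∀ i, PublicStrategy A S M i)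
    (h : List (∀ i, M i)) (t : ℕ) : EuclideanSpace ℝ (Fin n) :=
  ∑ l : Fin t → (∀ i, M i),
    G.pathProb σ h (List.ofFn l) • G.g (actAt σ (h ++ List.ofFn l))

/-- The discounted average continuation payoff profile `w^σ(h)` after the public history `h`. -/
def contPayoff (G : PrivateMonitoringGame A S M) (δ : ℝ) (σ : ∀ i, PublicStrategy A S M i)
    (h : List (∀ i, M i)) : EuclideanSpace ℝ (Fin n) :=
  (1 - δ) • ∑' t : ℕ, δ ^ t • G.expectedStagePayoff σ h t

/-- The one-shot deviation `d` of player `i` at `h` is nontrivial: it changes the action or the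
distribution of the continuation payoff profile from the next period on. -/
def IsNontrivialDeviation (G : PrivateMonitoringGame A S M) (δ : ℝ)
    (σ : ∀ i, PublicStrategy A S M i) (h : List (∀ i, M i)) (i : Fin n)
    (d : A i × (S i → M i)) : Prop :=
  d.1 ≠ actAt σ h i ∨
    valueDist (G.devDist (actAt σ h) (msgAt σ h) i d) (fun m => G.contPayoff δ σ (h ++ [m])) ≠
      valueDist (G.msgDist (actAt σ h) (msgAt σ h)) (fun m => G.contPayoff δ σ (h ++ [m]))

/-- `σ` is an `η`-uniformly strict perfect public equilibrium for the discount factor `δ`. -/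
def IsUSPPE (G : PrivateMonitoringGame A S M) (η δ : ℝ) (σ : ∀ i, PublicStrategy A S M i) :
    Prop :=
  ∀ (h : List (∀ i, M i)) (i : Fin n) (d : A i × (S i → M i)),
    G.IsNontrivialDeviation δ σ h i d →
      G.g (Function.update (actAt σ h) i d.1) i
          + δ / (1 - δ) * ∑ m, G.contPayoff δ σ (h ++ [m]) i
              * G.devDist (actAt σ h) (msgAt σ h) i d m
        ≤ G.g (actAt σ h) i
          + δ / (1 - δ) * ∑ m, G.contPayoff δ σ (h ++ [m]) i
              * G.msgDist (actAt σ h) (msgAt σ h) m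
          - η

/-- The set `E^η(δ)` of payoff profiles of `η`-uniformly strict perfect public equilibria. -/
def equilibriumPayoffs (G : PrivateMonitoringGame A S M) (η δ : ℝ) :
    Set (EuclideanSpace ℝ (Fin n)) :=
  {v | ∃ σ : ∀ i, PublicStrategy A S M i, G.IsUSPPE η δ σ ∧ v = G.contPayoff δ σ []}

end PrivateMonitoringGame

end RepeatedGame

end

/-! The argument is self-generation in the style of Fudenberg, Levine and Maskin. Let the
continuation payoff after `v` and message `m` be `v + ((1 - δ) / δ) • (v - g a + x m)` with `x` of
mean zero. Then `v` is the average of today's payoff and the continuation, and the weight `δ / (1 -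
δ)` turns the continuation into `x` plus a constant in the incentive constraints. So `x`, and with
it the slack `η`, need not depend on `δ`, while continuation payoffs move only by order `1 - δ`. A
bounded set closed under such decompositions consists of equilibrium payoffs
(`subset_equilibriumPayoffs`).

The set used is `K + closedBall 0 r` inside the interior of `V*(G)`. At `k + b`, a small step along
a vector with negative inner product with `b` lands in the open ball of radius `r` about `k`, hence
in the interior. It therefore suffices to find, for each interior `v` and each `l ≠ 0`, enforcing
payments with `v - g a + x m` strictly negative along `l` (`exists_enforces_direction`). The
payments are taken orthogonal to `l`, and `g a` is at least as high along `l` as all of `V*(G)`. If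
`l` has two nonzero coordinates, an extreme profile is used; if `l` is a multiple of a coordinate
vector, the best or the minmax profile of that player.

Existence of the payments is a finite linear system. By Farkas' lemma an obstruction is a family of
weighted deviations whose combined effect no admissible payment detects; the detectability and
identifiability conditions say that these deviations lose at least `η`. Compactness finally makes
the step size uniform, which gives the bound on `δ`. -/

namespace RepeatedGame

/-! ### Linear alternatives -/

section Farkas

variable {ι V : Type*} [AddCommGroup V] [Module ℝ V]

/-- **Farkas' lemma** for finitely many linear functionals. -/
theorem farkas_homogeneous (s : Finset ι) (f : ι → V →ₗ[ℝ] ℝ) (b : V →ₗ[ℝ] ℝ)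
    (h : ∀ x, (∀ i ∈ s, f i x ≤ 0) → b x ≤ 0) :
    ∃ u : ι → ℝ, (∀ i, 0 ≤ u i) ∧ b = ∑ i ∈ s, u i • f i := by
  classical
  induction s using Finset.induction_on generalizing f b with
  | empty =>
    refine ⟨0, fun _ => le_rfl, LinearMap.ext fun x => ?_⟩
    have h1 := h x (by simp)
    have h2 := h (-x) (by simp)
    simp only [map_neg] at h2
    simp only [Finset.sum_empty, LinearMap.zero_apply]
    linarith
  | insert k s hk ih =>
    by_cases hb : ∀ x, (∀ i ∈ s, f i x ≤ 0) → b x ≤ 0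
    · obtain ⟨u, hu, hbu⟩ := ih f b hb
      refine ⟨Function.update u k 0, fun i => ?_, ?_⟩
      · by_cases hi : i = k
        · subst hi; simp
        · simp [hi, hu i]
      · rw [Finset.sum_insert hk, hbu]
        simp only [Function.update_self, zero_smul, zero_add]
        refine Finset.sum_congr rfl fun i hi => ?_
        rw [Function.update_of_ne (ne_of_mem_of_not_mem hi hk)]
    · push Not at hb
      obtain ⟨z, hz, hbz⟩ := hb
      have hkz : 0 < f k z := by
        by_contra hcon
        refine absurd (h z fun i hi => ?_) (not_le.mpr hbz)
        rcases Finset.mem_insert.mp hi with rfl | hi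
        · exact not_lt.mp hcon
        · exact hz i hi
      -- Project along `z` onto the kernel of `f k`: there the constraint `k` is vacuous, so the
      -- induction hypothesis applies to the projected functionals.
      set c := (f k z)⁻¹ with hc
      have hcz : f k z * c = 1 := mul_inv_cancel₀ hkz.ne'
      have hc0 : 0 < c := inv_pos.mpr hkz
      obtain ⟨u, hu, hbu⟩ := ih (fun i => f i - (f i z * c) • f k) (b - (b z * c) • f k) (by
        intro x hx
        have := h (x - (f k x * c) • z) (fun i hi => by
          rcases Finset.mem_insert.mp hi with rfl | hi
          · simp only [map_sub, map_smul, smul_eq_mul]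
            have : f i x * c * f i z = f i x * (f i z * c) := by ring
            rw [this, hcz]; simp
          · have := hx i hi
            simp only [LinearMap.sub_apply, LinearMap.smul_apply, smul_eq_mul, map_sub,
              map_smul] at this ⊢
            linarith)
        simp only [LinearMap.sub_apply, LinearMap.smul_apply, smul_eq_mul, map_sub,
          map_smul] at this ⊢
        linarith)
      refine ⟨Function.update u k ((b z - ∑ i ∈ s, u i * f i z) * c), fun i => ?_, ?_⟩
      · by_cases hi : i = k
        · subst hi
          rw [Function.update_self]
          refine mul_nonneg (sub_nonneg.mpr (le_trans ?_ hbz.le)) hc0.le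
          exact Finset.sum_nonpos fun j hj => mul_nonpos_of_nonneg_of_nonpos (hu j) (hz j hj)
        · rw [Function.update_of_ne hi]; exact hu i
      · rw [Finset.sum_insert hk, Function.update_self]
        have h1 : ∑ i ∈ s, Function.update u k ((b z - ∑ i ∈ s, u i * f i z) * c) i • f i
            = ∑ i ∈ s, u i • f i := Finset.sum_congr rfl fun i hi => by
          rw [Function.update_of_ne (ne_of_mem_of_not_mem hi hk)]
        rw [h1]
        refine LinearMap.ext fun x => ?_
        have h2 := LinearMap.congr_fun hbu x
        simp only [LinearMap.sub_apply, LinearMap.smul_apply, smul_eq_mul, LinearMap.sum_apply,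
          LinearMap.add_apply, mul_sub, Finset.sum_sub_distrib] at h2 ⊢
        have h3 : ∑ i ∈ s, u i * (f i z * c * f k x) = (∑ i ∈ s, u i * f i z) * c * f k x := by
          rw [Finset.sum_mul, Finset.sum_mul]
          exact Finset.sum_congr rfl fun i _ => by ring
        rw [h3] at h2
        linear_combination h2

/-- A finite system of linear inequalities is solvable if no nonnegative combination of them is
contradictory. -/
theorem exists_forall_le_of_farkas [Fintype ι] (s : Finset ι) (f : ι → V →ₗ[ℝ] ℝ) (b : ι → ℝ)
    (h : ∀ u : ι → ℝ, (∀ i, 0 ≤ u i) → (∀ i, i ∉ s → u i = 0) → ∑ i, u i • f i = 0 →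
      0 ≤ ∑ i, u i * b i) :
    ∃ x, ∀ i ∈ s, f i x ≤ b i := by
  classical
  by_contra! hcon
  -- Homogenize with an extra variable `t`: unsolvability says that `f i x ≤ b i * t` and `-t ≤ 0`
  -- force `t ≤ 0`. Evaluating the resulting certificate at `(x, 0)` and `(0, 1)` contradicts `h`.
  obtain ⟨u, hu, hsum⟩ := farkas_homogeneous (V := V × ℝ) (insert none (s.image some))
    (fun o => o.elim (-LinearMap.snd ℝ V ℝ)
      fun i => f i ∘ₗ LinearMap.fst ℝ V ℝ - b i • LinearMap.snd ℝ V ℝ)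
    (LinearMap.snd ℝ V ℝ) (by
      rintro ⟨x, t⟩ hx
      by_contra! ht
      simp only [LinearMap.snd_apply] at ht
      obtain ⟨i, hi, hlt⟩ := hcon (t⁻¹ • x)
      have := hx (some i) (by simp [hi])
      simp only [Option.elim_some, LinearMap.sub_apply, LinearMap.comp_apply,
        LinearMap.fst_apply, LinearMap.smul_apply, LinearMap.snd_apply, smul_eq_mul] at this
      rw [map_smul, smul_eq_mul, ← div_eq_inv_mul, lt_div_iff₀ ht] at hlt
      linarith)
  rw [Finset.sum_insert (by simp), Finset.sum_image (by simp)] at hsum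
  have hval : ∀ x t, t = u none * (-t) + ∑ i ∈ s, u (some i) * (f i x - b i * t) := by
    intro x t
    have := LinearMap.congr_fun hsum (x, t)
    simpa [LinearMap.sum_apply] using this
  have h0 := h (fun i => if i ∈ s then u (some i) else 0)
    (fun i => by split_ifs; exacts [hu _, le_rfl])
    (fun i hi => if_neg hi) (by
      refine LinearMap.ext fun x => ?_
      have := hval x 0
      simp only [neg_zero, mul_zero, sub_zero, zero_add] at this
      simp [LinearMap.sum_apply, Finset.sum_ite_mem, ← this])
  have h1 := hval 0 1
  simp only [map_zero, zero_sub, mul_one, mul_neg, Finset.sum_neg_distrib] at h1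
  simp only [ite_mul, zero_mul, Finset.sum_ite_mem, Finset.univ_inter] at h0
  have := hu none
  linarith

end Farkas

/-! ### Message distributions and static incentives -/

namespace PrivateMonitoringGame

variable {n : ℕ} {A S M : Fin n → Type*}
  [∀ i, Fintype (A i)] [∀ i, Fintype (S i)] [∀ i, Fintype (M i)]
  [∀ i, DecidableEq (S i)] [∀ i, DecidableEq (M i)]

section Distributions

variable (G : PrivateMonitoringGame A S M)

theorem sum_mul_msgDist (a : ∀ i, A i) (ρ : ∀ i, S i → M i) (f : (∀ i, M i) → ℝ) :
    ∑ m, f m * G.msgDist a ρ m = ∑ s, f (fun i => ρ i (s i)) * G.p a s := by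
  classical
  simp only [msgDist, Finset.mul_sum, Finset.sum_filter]
  rw [Finset.sum_comm]
  refine Finset.sum_congr rfl fun s _ => ?_
  rw [Finset.sum_eq_single (fun i => ρ i (s i))]
  · simp
  · intro m _ hm
    rw [if_neg fun h => hm (funext fun i => (h i).symm), mul_zero]
  · simp

theorem sum_msgDist (a : ∀ i, A i) (ρ : ∀ i, S i → M i) : ∑ m, G.msgDist a ρ m = 1 := by
  have := G.sum_mul_msgDist a ρ fun _ => 1
  simpa [(G.p_mem a).2] using this

theorem sum_devDist (a : ∀ i, A i) (ρ : ∀ i, S i → M i) (i : Fin n) (d : A i × (S i → M i)) :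
    ∑ m, G.devDist a ρ i d m = 1 :=
  G.sum_msgDist _ _

theorem msgDist_nonneg (a : ∀ i, A i) (ρ : ∀ i, S i → M i) (m : ∀ i, M i) :
    0 ≤ G.msgDist a ρ m :=
  Finset.sum_nonneg fun s _ => (G.p_mem a).1 s

theorem devDist_self (a : ∀ i, A i) (ρ : ∀ i, S i → M i) (i : Fin n) :
    G.devDist a ρ i (a i, ρ i) = G.msgDist a ρ := by
  simp [devDist]

/-- Unnormalized deviation weights are a multiple of a mixed deviation. -/
theorem exists_mixedDeviation_of_weights (a : ∀ i, A i) (ρ : ∀ i, S i → M i) (i : Fin n) (η : ℝ)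
    (μ : A i × (S i → M i) → ℝ) (hμ : ∀ d, 0 ≤ μ d) (hμ0 : μ (a i, ρ i) = 0)
    (hne : μ ≠ 0) :
    ∃ c : ℝ, 0 < c ∧ ∃ φ ∈ mixedDeviations a ρ i,
      (∀ m, ∑ d, μ d * (G.devDist a ρ i d m - G.msgDist a ρ m)
        = c * (G.mixedDevDist a ρ i φ m - G.msgDist a ρ m)) ∧
      ∑ d, μ d * (G.g a i - G.g (Function.update a i d.1) i - η)
        = c * (G.g a i - G.mixedDevPayoff a i φ - η) := by
  have hc : 0 < ∑ d, μ d := by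
    refine lt_of_le_of_ne (Finset.sum_nonneg fun d _ => hμ d) fun h => hne ?_
    exact funext fun d =>
      (Finset.sum_eq_zero_iff_of_nonneg fun d _ => hμ d).mp h.symm d (Finset.mem_univ d)
  set c := ∑ d, μ d with hcdef
  have hcc : c * c⁻¹ = 1 := mul_inv_cancel₀ hc.ne'
  refine ⟨c, hc, fun d => c⁻¹ * μ d, ⟨⟨fun d => mul_nonneg (inv_nonneg.mpr hc.le) (hμ d), ?_⟩, ?_⟩,
    fun m => ?_, ?_⟩
  · rw [← Finset.mul_sum, inv_mul_cancel₀ hc.ne']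
  · simp [hμ0]
  · rw [mixedDevDist, mul_sub, Finset.mul_sum]
    simp only [mul_sub, Finset.sum_sub_distrib]
    rw [← Finset.sum_mul]
    congr 1
    exact Finset.sum_congr rfl fun d _ => by linear_combination (-G.devDist a ρ i d m * μ d) * hcc
  · have h1 : c * G.mixedDevPayoff a i (fun d => c⁻¹ * μ d)
        = ∑ d, μ d * G.g (Function.update a i d.1) i := by
      rw [mixedDevPayoff, Finset.mul_sum, Fintype.sum_prod_type]
      refine Finset.sum_congr rfl fun x _ => ?_
      dsimp only
      rw [← Finset.mul_sum, ← Finset.sum_mul]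
      linear_combination ((∑ r, μ (x, r)) * G.g (Function.update a i x) i) * hcc
    simp only [mul_sub, Finset.sum_sub_distrib, h1]
    rw [← Finset.sum_mul, ← Finset.sum_mul]

end Distributions

/-- Incentives for the players in `J` can be provided by payments in `V` if no family of weights on
deviations of these players is undetectable by `V` and too profitable. -/
theorem exists_payments (G : PrivateMonitoringGame A S M) (η : ℝ) (a : ∀ i, A i)
    (ρ : ∀ i, S i → M i) (J : Set (Fin n)) (V : Submodule ℝ ((∀ i, M i) → Fin n → ℝ))
    (h : ∀ μ : ∀ i, A i × (S i → M i) → ℝ, (∀ i d, 0 ≤ μ i d) → (∀ i, μ i (a i, ρ i) = 0) →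
      (∀ i, i ∉ J → μ i = 0) →
      (∀ x ∈ V, ∑ i, ∑ m, x m i * ∑ d, μ i d * (G.devDist a ρ i d m - G.msgDist a ρ m) = 0) →
      ∀ i, 0 ≤ ∑ d, μ i d * (G.g a i - G.g (Function.update a i d.1) i - η)) :
    ∃ x ∈ V, ∀ i ∈ J, ∀ d : A i × (S i → M i), d ≠ (a i, ρ i) →
      G.g (Function.update a i d.1) i + ∑ m, x m i * G.devDist a ρ i d m
        ≤ G.g a i + ∑ m, x m i * G.msgDist a ρ m - η := by
  classical
  let f : (Σ i, A i × (S i → M i)) → V →ₗ[ℝ] ℝ := fun k =>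
    { toFun := fun x => ∑ m, x.1 m k.1 * (G.devDist a ρ k.1 k.2 m - G.msgDist a ρ m)
      map_add' := fun x y => by
        simp [add_mul, Finset.sum_add_distrib]
      map_smul' := fun c x => by
        simp [Finset.mul_sum, mul_assoc] }
  have hf : ∀ k x, f k x = ∑ m, x.1 m k.1 * (G.devDist a ρ k.1 k.2 m - G.msgDist a ρ m) :=
    fun _ _ => rfl
  obtain ⟨x, hx⟩ := exists_forall_le_of_farkas
    (Finset.univ.filter fun k : (Σ i, A i × (S i → M i)) => k.1 ∈ J ∧ k.2 ≠ (a k.1, ρ k.1)) f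
    (fun k => G.g a k.1 - G.g (Function.update a k.1 k.2.1) k.1 - η) (by
      intro u hu hu0 hsum
      rw [Fintype.sum_sigma]
      refine Finset.sum_nonneg fun i _ => h (fun i d => u ⟨i, d⟩) (fun i d => hu _)
        (fun i => hu0 _ (by simp)) (fun i hi => funext fun d => hu0 _ (by simp [hi])) ?_ i
      intro x hx
      have := LinearMap.congr_fun hsum ⟨x, hx⟩
      rw [LinearMap.sum_apply, Fintype.sum_sigma] at this
      simp only [LinearMap.smul_apply, hf, smul_eq_mul, LinearMap.zero_apply] at this
      rw [← this]
      refine Finset.sum_congr rfl fun i _ => ?_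
      simp only [Finset.mul_sum]
      rw [Finset.sum_comm]
      exact Finset.sum_congr rfl fun d _ => Finset.sum_congr rfl fun m _ => by ring)
  refine ⟨x.1, x.2, fun i hi d hd => ?_⟩
  have := hx ⟨i, d⟩ (by simp [hi, hd])
  simp only [hf, mul_sub, Finset.sum_sub_distrib] at this
  linarith

/-- Payments `x` after the public messages make `(a, ρ)` an `η`-strict static equilibrium, up to
deviations in messages that leave the law of `x` unchanged. -/
def Enforces (G : PrivateMonitoringGame A S M) (η : ℝ) (a : ∀ i, A i) (ρ : ∀ i, S i → M i)
    (x : (∀ i, M i) → EuclideanSpace ℝ (Fin n)) : Prop :=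
  ∀ i, ∀ d : A i × (S i → M i),
    G.g (Function.update a i d.1) i + ∑ m, x m i * G.devDist a ρ i d m
        ≤ G.g a i + ∑ m, x m i * G.msgDist a ρ m - η ∨
      d.1 = a i ∧ ∀ F : EuclideanSpace ℝ (Fin n) → ℝ,
        ∑ m, F (x m) * G.devDist a ρ i d m = ∑ m, F (x m) * G.msgDist a ρ m

/-- All message laws have total mass one, so a constant cancels from both sides. This allows
payments to be centred. -/
theorem Enforces.sub_const {G : PrivateMonitoringGame A S M} {η : ℝ} {a : ∀ i, A i}
    {ρ : ∀ i, S i → M i} {x : (∀ i, M i) → EuclideanSpace ℝ (Fin n)}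
    (h : G.Enforces η a ρ x) (c : EuclideanSpace ℝ (Fin n)) :
    G.Enforces η a ρ fun m => x m - c := by
  intro i d
  rcases h i d with h | ⟨h1, h2⟩
  · left
    simp only [PiLp.sub_apply, sub_mul, Finset.sum_sub_distrib]
    rw [← Finset.mul_sum, ← Finset.mul_sum, G.sum_devDist, G.sum_msgDist]
    linarith
  · exact Or.inr ⟨h1, fun F => h2 fun y => F (y - c)⟩

/-- At a profile that is detectable and identifiable, incentives can be provided by payments on any
hyperplane whose normal has two nonzero coordinates. -/
theorem exists_enforces_hyperplane (G : PrivateMonitoringGame A S M) {η : ℝ} {a : ∀ i, A i}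
    {ρ : ∀ i, S i → M i} (hd : G.DetectableWith η a ρ) (hi : G.IdentifiableWith η a ρ)
    (l : EuclideanSpace ℝ (Fin n)) (hl : ∀ i, ∃ j, j ≠ i ∧ l j ≠ 0) :
    ∃ x, G.Enforces η a ρ x ∧ ∀ m, ⟪l, x m⟫ = 0 := by
  classical
  let V : Submodule ℝ ((∀ i, M i) → Fin n → ℝ) :=
    { carrier := {x | ∀ m, ∑ i, l i * x m i = 0}
      add_mem' := fun {x y} hx hy m => by
        simp [mul_add, Finset.sum_add_distrib, hx m, hy m]
      zero_mem' := fun m => by simp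
      smul_mem' := fun c x hx m => by
        have := hx m
        simp only [Pi.smul_apply, smul_eq_mul, mul_left_comm _ c, ← Finset.mul_sum, this, mul_zero] }
  obtain ⟨x, hxV, hx⟩ := G.exists_payments η a ρ Set.univ V (by
    intro μ hμ hμ0 _ hV i
    by_cases hμi : μ i = 0
    · simp [hμi]
    obtain ⟨c, hc, φ, hφ, hφd, hφL⟩ :=
      G.exists_mixedDeviation_of_weights a ρ i η (μ i) (hμ i) (hμ0 i) hμi
    rw [hφL]
    refine mul_nonneg hc.le ?_
    obtain ⟨j, hji, hlj⟩ := hl i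
    -- Test with the transfer, after `m` only, of `l j` to player `i` and `-l i` to player `j`,
    -- which stays on the hyperplane. The effects of the two players' deviations are thus
    -- proportional.
    have key : ∀ m, l j * (∑ d, μ i d * (G.devDist a ρ i d m - G.msgDist a ρ m))
        = l i * ∑ d, μ j d * (G.devDist a ρ j d m - G.msgDist a ρ m) := by
      intro m
      have := hV (fun m' k => if m' = m then (if k = i then l j else if k = j then - l i else 0)
        else 0) (by
          intro m'
          by_cases hm : m' = m
          · simp only [hm, if_true]
            rw [Fintype.sum_eq_add i j hji.symm fun k hk => by simp [hk.1, hk.2]]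
            simp only [if_true, if_neg hji]
            ring
          · simp [hm])
      simp only [ite_mul, zero_mul, Finset.sum_ite_eq', Finset.mem_univ, if_true] at this
      rw [Fintype.sum_eq_add i j hji.symm fun k hk => by simp [hk.1, hk.2]] at this
      simp only [if_true, if_neg hji] at this
      linarith
    have heq : G.mixedDevDist a ρ i φ = G.msgDist a ρ → η ≤ G.g a i - G.mixedDevPayoff a i φ :=
      hd i φ hφ
    by_cases hμj : μ j = 0
    · have := heq (funext fun m => by
        have h1 := key m
        rw [hφd m, hμj] at h1
        simp only [Pi.zero_apply, zero_mul, Finset.sum_const_zero, mul_zero] at h1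
        have h2 := (mul_eq_zero.mp ((mul_eq_zero.mp h1).resolve_left hlj)).resolve_left hc.ne'
        linarith)
      linarith
    obtain ⟨c', hc', ψ, hψ, hψd, -⟩ :=
      G.exists_mixedDeviation_of_weights a ρ j η (μ j) (hμ j) (hμ0 j) hμj
    have := (hi i j hji.symm φ hφ ψ hψ (by
      intro hli
      have := LinearIndependent.pair_iff.mp hli (l j * c) (-(l i * c')) (by
        funext m
        have h1 := key m
        rw [hφd m, hψd m] at h1
        simp only [Pi.add_apply, Pi.smul_apply, Pi.sub_apply, smul_eq_mul, Pi.zero_apply]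
        linarith)
      exact mul_ne_zero hlj hc.ne' this.1)).trans (min_le_left _ _)
    linarith)
  refine ⟨fun m => WithLp.toLp 2 (x m), fun i d => ?_, fun m => ?_⟩
  · by_cases hdd : d = (a i, ρ i)
    · subst hdd
      exact Or.inr ⟨rfl, fun F => by rw [G.devDist_self]⟩
    · exact Or.inl (hx i trivial d hdd)
  · rw [PiLp.inner_apply, ← hxV m]
    exact Finset.sum_congr rfl fun i _ => by simp [mul_comm]

/-- If player `i` has a strict best response and the others are detectable without `i`'s messages,
incentives can be provided by payments with vanishing `i`-th coordinate. -/
theorem exists_enforces_coordinate (G : PrivateMonitoringGame A S M) {η : ℝ} {a : ∀ i, A i}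
    {i : Fin n} (hs : G.StarDetectable η i a)
    (hbr : ∀ y : A i, y ≠ a i → η ≤ G.g a i - G.g (Function.update a i y) i) :
    ∃ ρ x, G.Enforces η a ρ x ∧ ∀ m, x m i = 0 := by
  classical
  obtain ⟨ρ, hρ⟩ := hs
  -- Payments ignore the messages of `i`, so that `i`, who is paid nothing, cannot influence them by
  -- misreporting: such deviations are trivial rather than strictly deterred.
  let V : Submodule ℝ ((∀ i, M i) → Fin n → ℝ) :=
    { carrier := {x | (∀ m, x m i = 0) ∧ ∀ m m', (∀ k, k ≠ i → m k = m' k) → x m = x m'}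
      add_mem' := fun {x y} hx hy => ⟨fun m => by simp [hx.1 m, hy.1 m], fun m m' h => by
        simp [hx.2 m m' h, hy.2 m m' h]⟩
      zero_mem' := ⟨fun m => rfl, fun _ _ _ => rfl⟩
      smul_mem' := fun c x hx => ⟨fun m => by simp [hx.1 m], fun m m' h => by
        simp [hx.2 m m' h]⟩ }
  obtain ⟨x, hxV, hx⟩ := G.exists_payments η a ρ {i}ᶜ V (by
    intro μ hμ hμ0 hJ hV j
    by_cases hμj : μ j = 0
    · simp [hμj]
    have hji : j ≠ i := by
      rintro rfl
      exact hμj (hJ j (by simp))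
    obtain ⟨c, hc, φ, hφ, hφd, hφL⟩ :=
      G.exists_mixedDeviation_of_weights a ρ j η (μ j) (hμ j) (hμ0 j) hμj
    rw [hφL]
    refine mul_nonneg hc.le ?_
    have := hρ j hji φ hφ (by
      funext t
      -- Paying `j` the indicator of the others' messages being `t` reads off the marginal on
      -- `M_{-i}` at `t`.
      have := hV (fun m k => if k = j then (if ∀ r : {r : Fin n // r ≠ i}, m r = t r then 1 else 0)
        else 0) ⟨fun m => by simp [hji.symm], fun m m' h => by
          have : (∀ r : {r : Fin n // r ≠ i}, m r = t r) ↔ ∀ r : {r : Fin n // r ≠ i}, m' r = t r :=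
            forall_congr' fun r => by rw [h r r.2]
          simp only [this]⟩
      rw [Finset.sum_eq_single j (fun k _ hk => by simp [hk]) (by simp)] at this
      simp only [if_true, hφd, ite_mul, one_mul, zero_mul, ← Finset.sum_filter, ← Finset.mul_sum,
        Finset.sum_sub_distrib] at this
      have := (mul_eq_zero.mp this).resolve_left hc.ne'
      exact sub_eq_zero.mp this)
    linarith)
  refine ⟨ρ, fun m => WithLp.toLp 2 (x m), fun j d => ?_, fun m => hxV.1 m⟩
  by_cases hj : j = i
  · subst hj
    by_cases hd : d.1 = a j
    · refine Or.inr ⟨hd, fun F => ?_⟩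
      rw [devDist, hd, Function.update_eq_self, sum_mul_msgDist, sum_mul_msgDist]
      refine Finset.sum_congr rfl fun s _ => ?_
      exact congrArg (fun y => F (WithLp.toLp 2 y) * G.p a s)
        (hxV.2 _ _ fun k hk => by simp [hk])
    · left
      simp only [hxV.1, zero_mul, Finset.sum_const_zero]
      linarith [hbr d.1 hd]
  · by_cases hdd : d = (a j, ρ j)
    · subst hdd
      exact Or.inr ⟨rfl, fun F => by rw [G.devDist_self]⟩
    · exact Or.inl (hx j (by simpa using hj) d hdd)

end PrivateMonitoringGame

end RepeatedGame

namespace RepeatedGame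

/-! ### Rounded convex sets -/

section Geometry

open Set Filter Topology
open scoped Pointwise

variable {E : Type*} [NormedAddCommGroup E] [InnerProductSpace ℝ E]

/-- A nonzero linear functional stays strictly below its upper bounds on the interior. -/
theorem inner_lt_of_mem_interior {s : Set E} {v l : E} {c : ℝ} (hv : v ∈ interior s) (hl : l ≠ 0)
    (h : ∀ w ∈ s, ⟪l, w⟫ ≤ c) : ⟪l, v⟫ < c := by
  have h1 : ∀ᶠ t in 𝓝[>] (0 : ℝ), v + t • l ∈ s := by
    have : Tendsto (fun t : ℝ => v + t • l) (𝓝[>] 0) (𝓝 v) := by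
      have : Continuous fun t : ℝ => v + t • l := by fun_prop
      simpa using (this.tendsto 0).mono_left nhdsWithin_le_nhds
    exact this.eventually (mem_interior_iff_mem_nhds.mp hv)
  obtain ⟨t, ht, ht0⟩ := (h1.and self_mem_nhdsWithin).exists
  have h2 := h _ ht
  rw [inner_add_right, inner_smul_right] at h2
  have : 0 < t * ⟪l, l⟫ := mul_pos ht0 (real_inner_self_pos.mpr hl)
  linarith

/-- In the second case the squared norm has derivative `2 * ⟪b, y⟫ < 0` at `t = 0`; the first is
continuity. -/
theorem eventually_add_smul_mem_ball {b y : E} {r : ℝ} (hb : ‖b‖ ≤ r)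
    (h : ‖b‖ < r ∨ ⟪b, y⟫ < 0) : ∀ᶠ t in 𝓝[>] (0 : ℝ), ‖b + t • y‖ < r := by
  rcases h with h | h
  · have : Tendsto (fun t : ℝ => ‖b + t • y‖) (𝓝[>] 0) (𝓝 ‖b‖) := by
      have : Continuous fun t : ℝ => ‖b + t • y‖ := by fun_prop
      simpa using (this.tendsto 0).mono_left nhdsWithin_le_nhds
    exact this.eventually (gt_mem_nhds h)
  · have h1 : ∀ᶠ t in 𝓝[>] (0 : ℝ), 2 * ⟪b, y⟫ + t * ‖y‖ ^ 2 < 0 := by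
      have : Tendsto (fun t : ℝ => 2 * ⟪b, y⟫ + t * ‖y‖ ^ 2) (𝓝[>] 0) (𝓝 (2 * ⟪b, y⟫)) := by
        have : Continuous fun t : ℝ => 2 * ⟪b, y⟫ + t * ‖y‖ ^ 2 := by fun_prop
        simpa using (this.tendsto 0).mono_left nhdsWithin_le_nhds
      exact this.eventually (gt_mem_nhds (by linarith))
    filter_upwards [h1, self_mem_nhdsWithin] with t ht ht0
    have ht0 : 0 < t := ht0
    refine lt_of_lt_of_le (lt_of_pow_lt_pow_left₀ 2 (norm_nonneg b) ?_) hb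
    rw [norm_add_sq_real, inner_smul_right, norm_smul, mul_pow, Real.norm_eq_abs, sq_abs]
    nlinarith

/-- Comparison with the point of the ball about `k` farthest along `l` forces equality in
Cauchy–Schwarz for `l` and `b`. -/
theorem eq_smul_of_isSupporting_add_closedBall {K : Set E} {r : ℝ} (hr : 0 < r) {k b l : E}
    (hk : k ∈ K) (hb : ‖b‖ ≤ r) (hl : l ≠ 0)
    (h : ∀ x ∈ K + Metric.closedBall (0 : E) r, ⟪l, x⟫ ≤ ⟪l, k + b⟫) :
    l = (‖l‖ / r) • b := by
  have hl0 : 0 < ‖l‖ := norm_pos_iff.mpr hl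
  have h1 := h (k + (r / ‖l‖) • l) (add_mem_add hk (by
    rw [mem_closedBall_zero_iff, norm_smul, Real.norm_of_nonneg (by positivity)]
    field_simp; rfl))
  rw [inner_add_right, inner_add_right, inner_smul_right, real_inner_self_eq_norm_sq] at h1
  have h2 : r * ‖l‖ ≤ ⟪l, b⟫ := by
    have : r / ‖l‖ * ‖l‖ ^ 2 = r * ‖l‖ := by field_simp
    linarith
  have h3 : ‖r • l - ‖l‖ • b‖ ^ 2 ≤ 0 := by
    rw [norm_sub_sq_real, inner_smul_left, inner_smul_right, norm_smul, norm_smul,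
      Real.norm_of_nonneg hr.le, norm_norm]
    simp only [conj_trivial]
    have h4 : r * (‖l‖ * (r * ‖l‖)) ≤ r * (‖l‖ * ⟪l, b⟫) := by gcongr
    have h5 : (‖l‖ * ‖b‖) ^ 2 ≤ (‖l‖ * r) ^ 2 := by gcongr
    nlinarith
  have h4 : r • l = ‖l‖ • b := by
    have := pow_eq_zero_iff (two_ne_zero) |>.mp (le_antisymm h3 (sq_nonneg _))
    exact sub_eq_zero.mp (norm_eq_zero.mp this)
  rw [div_eq_inv_mul, mul_smul, ← h4, smul_smul, inv_mul_cancel₀ hr.ne', one_smul]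

theorem ball_subset_interior_add_closedBall {F : Type*} [SeminormedAddCommGroup F] {K : Set F}
    {r : ℝ} {k : F} (hk : k ∈ K) :
    Metric.ball k r ⊆ interior (K + Metric.closedBall (0 : F) r) :=
  interior_maximal (fun x hx => ⟨k, hk, x - k, by
    simpa [dist_eq_norm] using (Metric.mem_ball.mp hx).le, by simp⟩) Metric.isOpen_ball

/-- Any supporting normal at `k + b` is a positive multiple of `b`, which gives uniqueness;
existence is Hahn–Banach. -/
theorem isSmoothCompactConvex_add_closedBall {n : ℕ} {K : Set (EuclideanSpace ℝ (Fin n))}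
    (hne : K.Nonempty) (hK : IsCompact K) (hconv : Convex ℝ K) {r : ℝ} (hr : 0 < r) :
    IsSmoothCompactConvex (K + Metric.closedBall (0 : EuclideanSpace ℝ (Fin n)) r) := by
  have hWc : Convex ℝ (K + Metric.closedBall (0 : EuclideanSpace ℝ (Fin n)) r) :=
    hconv.add (convex_closedBall _ _)
  have hWk : IsCompact (K + Metric.closedBall (0 : EuclideanSpace ℝ (Fin n)) r) :=
    hK.add (isCompact_closedBall _ _)
  refine ⟨hne.add ⟨0, by simp [hr.le]⟩, hWk, hWc, fun v hv => ?_⟩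
  have hvW := hWk.isClosed.frontier_subset hv
  obtain ⟨k, hk, b, hb, rfl⟩ := hvW
  rw [mem_closedBall_zero_iff] at hb
  have key : ∀ H, IsSupportingHyperplane (K + Metric.closedBall 0 r) H (k + b) →
      H = {x | ⟪b, x⟫ = ⟪b, k + b⟫} := by
    rintro H ⟨l, hl, rfl, hsup⟩
    have h1 := eq_smul_of_isSupporting_add_closedBall hr hk hb hl hsup
    have hc : ‖l‖ / r ≠ 0 := div_ne_zero (norm_ne_zero_iff.mpr hl) hr.ne'
    ext x
    simp only [mem_ofPred_eq]
    rw [h1, inner_smul_left, inner_smul_left]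
    exact mul_right_inj' (by simpa using hc)
  have hex : ∃ H, IsSupportingHyperplane (K + Metric.closedBall 0 r) H (k + b) := by
    have hint : (interior (K + Metric.closedBall (0 : EuclideanSpace ℝ (Fin n)) r)).Nonempty :=
      ⟨k, ball_subset_interior_add_closedBall hk (by simpa using hr)⟩
    obtain ⟨f, hf⟩ := geometric_hahn_banach_open_point hWc.interior isOpen_interior hv.2
    set l := (InnerProductSpace.toDual ℝ (EuclideanSpace ℝ (Fin n))).symm f with hl
    have hfl : ∀ x, f x = ⟪l, x⟫ := fun x => by simp [hl]
    refine ⟨_, l, fun h0 => ?_, rfl, fun x hx => ?_⟩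
    · obtain ⟨z, hz⟩ := hint
      have := hf z hz
      rw [hfl, hfl, h0] at this
      simp at this
    · have hcl : x ∈ closure (interior (K + Metric.closedBall (0 : EuclideanSpace ℝ (Fin n)) r)) := by
        rw [hWc.closure_interior_eq_closure_of_nonempty_interior hint]
        exact subset_closure hx
      rw [← hfl, ← hfl]
      exact closure_minimal (fun y hy => (hf y hy).le)
        (isClosed_le f.continuous continuous_const) hcl
  obtain ⟨H, hH⟩ := hex
  exact ⟨H, hH, fun H' hH' => (key H' hH').trans (key H hH).symm⟩

end Geometry

/-! ### Feasible payoffs and enforceable directions -/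

namespace PrivateMonitoringGame

variable {n : ℕ} {A S M : Fin n → Type*}
  [∀ i, Fintype (A i)] [∀ i, Fintype (S i)] [∀ i, Fintype (M i)]
  [∀ i, DecidableEq (S i)] [∀ i, DecidableEq (M i)]

theorem isCompact_feasible (G : PrivateMonitoringGame A S M) : IsCompact G.feasible :=
  (Set.finite_range G.g).isCompact_convexHull (𝕜 := ℝ)

theorem feasibleIR_eq (G : PrivateMonitoringGame A S M) :
    G.feasibleIR = G.feasible ∩ ⋂ i, {v | 0 ≤ v i} := by
  ext v; simp [feasibleIR]

theorem isCompact_feasibleIR (G : PrivateMonitoringGame A S M) : IsCompact G.feasibleIR := by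
  rw [feasibleIR_eq]
  exact G.isCompact_feasible.inter_right
    (isClosed_iInter fun i => isClosed_le continuous_const (by fun_prop))

theorem convex_feasibleIR (G : PrivateMonitoringGame A S M) : Convex ℝ G.feasibleIR := by
  rw [feasibleIR_eq]
  refine (convex_convexHull ℝ _).inter (convex_iInter fun i x hx y hy s t hs ht _ => ?_)
  have hx : 0 ≤ x i := hx
  have hy : 0 ≤ y i := hy
  change 0 ≤ s * x i + t * y i
  positivity

/-- Some profile in `A(G)` maximizes a given linear functional on `V(G)`. -/
theorem exists_extremeProfile_max (G : PrivateMonitoringGame A S M) (hne : G.feasible.Nonempty)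
    (l : EuclideanSpace ℝ (Fin n)) :
    ∃ a ∈ G.extremeProfiles, ∀ w ∈ G.feasible, ⟪l, w⟫ ≤ ⟪l, G.g a⟫ := by
  -- The face of maximizers has an extreme point, which is extreme in `V(G)` too and hence some `G.g
  -- a`.
  have hexp : IsExposed ℝ G.feasible ((innerSL ℝ l).toExposed G.feasible) :=
    ContinuousLinearMap.toExposed.isExposed
  have hcomp : IsCompact ((innerSL ℝ l).toExposed G.feasible) := hexp.isCompact G.isCompact_feasible
  have hne' : ((innerSL ℝ l).toExposed G.feasible).Nonempty := by
    obtain ⟨w, hw, hmax⟩ := G.isCompact_feasible.exists_isMaxOn hne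
      (innerSL ℝ l).continuous.continuousOn
    exact ⟨w, hw, fun y hy => hmax hy⟩
  obtain ⟨w, hw⟩ := hcomp.extremePoints_nonempty hne'
  have hw' := hexp.isExtreme.extremePoints_subset_extremePoints hw
  obtain ⟨a, rfl⟩ := extremePoints_convexHull_subset hw'
  exact ⟨a, hw', fun y hy => by simpa using hw.1.2 y hy⟩

/-- Every direction is enforceable at every payoff profile in the interior of `V*(G)`. -/
theorem exists_enforces_direction (G : PrivateMonitoringGame A S M) {η : ℝ}
    {best worst : Fin n → ∀ i, A i} (hbr : G.BestResponseProperty η best worst)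
    (hdet : ∀ a ∈ G.extremeProfiles, ∃ ρ : ∀ i, S i → M i,
      G.DetectableWith η a ρ ∧ G.IdentifiableWith η a ρ)
    (hstar : ∀ i, G.StarDetectable η i (best i) ∧ G.StarDetectable η i (worst i))
    {v l : EuclideanSpace ℝ (Fin n)} (hv : v ∈ interior G.feasibleIR) (hl : l ≠ 0) :
    ∃ a ρ x, G.Enforces η a ρ x ∧ ∑ m, G.msgDist a ρ m • x m = 0 ∧
      ∀ m, ⟪l, v - G.g a + x m⟫ < 0 := by
  suffices h : ∃ a ρ x, G.Enforces η a ρ x ∧ (∀ m, ⟪l, x m⟫ = 0) ∧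
      ∀ w ∈ G.feasibleIR, ⟪l, w⟫ ≤ ⟪l, G.g a⟫ by
    obtain ⟨a, ρ, x, hx, hlx, ha⟩ := h
    refine ⟨a, ρ, _, hx.sub_const (∑ m, G.msgDist a ρ m • x m), ?_, fun m => ?_⟩
    · simp only [smul_sub, Finset.sum_sub_distrib]
      rw [← Finset.sum_smul, G.sum_msgDist, one_smul, sub_self]
    · have h1 : ⟪l, ∑ m, G.msgDist a ρ m • x m⟫ = 0 := by
        rw [inner_sum]
        exact Finset.sum_eq_zero fun m _ => by rw [inner_smul_right, hlx, mul_zero]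
      rw [inner_add_right, inner_sub_right, inner_sub_right, hlx, h1]
      linarith [inner_lt_of_mem_interior hv hl ha]
  have hvf := interior_subset hv
  by_cases hcase : ∀ i, ∃ j, j ≠ i ∧ l j ≠ 0
  · obtain ⟨a, ha, hmax⟩ := G.exists_extremeProfile_max ⟨v, hvf.1⟩ l
    obtain ⟨ρ, hd, hi⟩ := hdet a ha
    obtain ⟨x, hx, hlx⟩ := G.exists_enforces_hyperplane hd hi l hcase
    exact ⟨a, ρ, x, hx, hlx, fun w hw => hmax w hw.1⟩
  · push Not at hcase
    obtain ⟨i, hi⟩ := hcase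
    have hin : ∀ w : EuclideanSpace ℝ (Fin n), ⟪l, w⟫ = l i * w i := by
      intro w
      rw [PiLp.inner_apply, Finset.sum_eq_single i (fun j _ hj => by simp [hi j hj]) (by simp)]
      simp [mul_comm]
    have hli : l i ≠ 0 := fun h0 => hl <| by
      ext j
      by_cases hj : j = i
      · subst hj; exact h0
      · exact hi j hj
    rcases lt_or_gt_of_ne hli with hneg | hpos
    · obtain ⟨ρ, x, hx, hxi⟩ := G.exists_enforces_coordinate (hstar i).2 (hbr i).2.2
      -- Only individual rationality gives this bound: payoffs of `i` in `V(G)` may lie below the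
      -- minmax value `0`.
      refine ⟨worst i, ρ, x, hx, fun m => by rw [hin, hxi, mul_zero], fun w hw => ?_⟩
      rw [hin, hin, (hbr i).2.1, G.minmax_eq_zero, mul_zero]
      exact mul_nonpos_of_nonpos_of_nonneg hneg.le (hw.2 i)
    · obtain ⟨ρ, x, hx, hxi⟩ := G.exists_enforces_coordinate (hstar i).1 (hbr i).1.2
      refine ⟨best i, ρ, x, hx, fun m => by rw [hin, hxi, mul_zero], fun w hw => ?_⟩
      rw [hin, hin]
      refine mul_le_mul_of_nonneg_left ?_ hpos.le
      refine convexHull_min (t := {w : EuclideanSpace ℝ (Fin n) | w i ≤ G.g (best i) i}) ?_ ?_ hw.1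
      · rintro _ ⟨a, rfl⟩
        exact (hbr i).1.1 a
      · exact convex_halfSpace_le (f := fun w : EuclideanSpace ℝ (Fin n) => w i)
          ⟨fun _ _ => rfl, fun _ _ => rfl⟩ _

/-! ### Recursion for continuation payoffs -/

section Dynamics

variable (G : PrivateMonitoringGame A S M) (σ : ∀ i, PublicStrategy A S M i)

theorem expectedStagePayoff_zero (h : List (∀ i, M i)) :
    G.expectedStagePayoff σ h 0 = G.g (actAt σ h) := by
  simp [expectedStagePayoff, pathProb]

theorem expectedStagePayoff_succ (h : List (∀ i, M i)) (t : ℕ) :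
    G.expectedStagePayoff σ h (t + 1)
      = ∑ m, G.msgDist (actAt σ h) (msgAt σ h) m • G.expectedStagePayoff σ (h ++ [m]) t := by
  simp only [expectedStagePayoff, Finset.smul_sum]
  rw [← Fintype.sum_prod_type', ← (Fin.consEquiv fun _ => ∀ i, M i).sum_comp]
  refine Fintype.sum_congr _ _ fun q => ?_
  simp [Fin.consEquiv, List.ofFn_succ, pathProb, mul_smul]

theorem norm_expectedStagePayoff_le {C : ℝ} (hC : ∀ a, ‖G.g a‖ ≤ C) (h : List (∀ i, M i))
    (t : ℕ) : ‖G.expectedStagePayoff σ h t‖ ≤ C := by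
  induction t generalizing h with
  | zero => rw [expectedStagePayoff_zero]; exact hC _
  | succ t ih =>
    rw [expectedStagePayoff_succ]
    calc _ ≤ ∑ m, G.msgDist (actAt σ h) (msgAt σ h) m * C := by
          refine norm_sum_le_of_le _ fun m _ => ?_
          rw [norm_smul, Real.norm_of_nonneg (G.msgDist_nonneg _ _ _)]
          exact mul_le_mul_of_nonneg_left (ih _) (G.msgDist_nonneg _ _ _)
      _ = C := by rw [← Finset.sum_mul, G.sum_msgDist, one_mul]

theorem exists_norm_payoff_le : ∃ C, ∀ a, ‖G.g a‖ ≤ C := by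
  obtain ⟨C, hC⟩ := (Set.finite_range fun a => ‖G.g a‖).bddAbove
  exact ⟨C, fun a => hC ⟨a, rfl⟩⟩

theorem summable_expectedStagePayoff {δ : ℝ} (hδ : δ ∈ Set.Ioo (0 : ℝ) 1)
    (h : List (∀ i, M i)) :
    Summable fun t : ℕ => δ ^ t • G.expectedStagePayoff σ h t := by
  obtain ⟨C, hC⟩ := G.exists_norm_payoff_le
  refine Summable.of_norm_bounded (g := fun t => δ ^ t * C)
    ((summable_geometric_of_lt_one hδ.1.le hδ.2).mul_right C) fun t => ?_
  rw [norm_smul, Real.norm_of_nonneg (pow_nonneg hδ.1.le t)]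
  exact mul_le_mul_of_nonneg_left (G.norm_expectedStagePayoff_le σ hC h t) (pow_nonneg hδ.1.le t)

theorem exists_norm_contPayoff_le {δ : ℝ} (hδ : δ ∈ Set.Ioo (0 : ℝ) 1) :
    ∃ C, ∀ h, ‖G.contPayoff δ σ h‖ ≤ C := by
  obtain ⟨C, hC⟩ := G.exists_norm_payoff_le
  refine ⟨(1 - δ) * ((1 - δ)⁻¹ * C), fun h => ?_⟩
  rw [contPayoff, norm_smul, Real.norm_of_nonneg (by linarith [hδ.2])]
  refine mul_le_mul_of_nonneg_left ?_ (by linarith [hδ.2])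
  refine tsum_of_norm_bounded ((hasSum_geometric_of_lt_one hδ.1.le hδ.2).mul_right C) fun t => ?_
  rw [norm_smul, Real.norm_of_nonneg (pow_nonneg hδ.1.le t)]
  exact mul_le_mul_of_nonneg_left (G.norm_expectedStagePayoff_le σ hC h t) (pow_nonneg hδ.1.le t)

theorem contPayoff_eq {δ : ℝ} (hδ : δ ∈ Set.Ioo (0 : ℝ) 1) (h : List (∀ i, M i)) :
    G.contPayoff δ σ h = (1 - δ) • G.g (actAt σ h)
      + δ • ∑ m, G.msgDist (actAt σ h) (msgAt σ h) m • G.contPayoff δ σ (h ++ [m]) := by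
  have hs := G.summable_expectedStagePayoff σ hδ
  rw [contPayoff, (hs h).tsum_eq_zero_add, smul_add, pow_zero, one_smul, expectedStagePayoff_zero]
  congr 1
  have hterm : ∀ t : ℕ, δ ^ (t + 1) • G.expectedStagePayoff σ h (t + 1)
      = ∑ m, (δ * G.msgDist (actAt σ h) (msgAt σ h) m) •
        δ ^ t • G.expectedStagePayoff σ (h ++ [m]) t := fun t => by
    rw [expectedStagePayoff_succ, Finset.smul_sum]
    refine Finset.sum_congr rfl fun m _ => ?_
    simp only [smul_smul]
    congr 1
    ring
  simp only [hterm, contPayoff]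
  rw [Summable.tsum_finsetSum fun m _ => (hs (h ++ [m])).const_smul _, Finset.smul_sum,
    Finset.smul_sum]
  refine Finset.sum_congr rfl fun m _ => ?_
  rw [(hs (h ++ [m])).tsum_const_smul]
  simp only [smul_smul]
  congr 1
  ring

/-- The continuation payoff is the only bounded solution of its recursion. -/
theorem contPayoff_eq_of_recursion {δ : ℝ} (hδ : δ ∈ Set.Ioo (0 : ℝ) 1)
    (w : List (∀ i, M i) → EuclideanSpace ℝ (Fin n)) {B : ℝ}
    (hB : ∀ h, ‖w h‖ ≤ B)
    (hw : ∀ h, w h = (1 - δ) • G.g (actAt σ h)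
      + δ • ∑ m, G.msgDist (actAt σ h) (msgAt σ h) m • w (h ++ [m])) (h : List (∀ i, M i)) :
    G.contPayoff δ σ h = w h := by
  obtain ⟨C, hC⟩ := G.exists_norm_contPayoff_le σ hδ
  -- Each unrolling of the two recursions contracts their distance by `δ`, uniformly in the history.
  have key : ∀ k h, ‖G.contPayoff δ σ h - w h‖ ≤ δ ^ k * (C + B) := by
    intro k
    induction k with
    | zero =>
      intro h
      rw [pow_zero, one_mul]
      exact (norm_sub_le _ _).trans (add_le_add (hC h) (hB h))
    | succ k ih =>
      intro h
      rw [G.contPayoff_eq σ hδ, hw h, add_sub_add_left_eq_sub, ← smul_sub,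
        ← Finset.sum_sub_distrib, norm_smul, Real.norm_of_nonneg hδ.1.le, pow_succ', mul_assoc]
      refine mul_le_mul_of_nonneg_left ?_ hδ.1.le
      calc _ ≤ ∑ m, G.msgDist (actAt σ h) (msgAt σ h) m * (δ ^ k * (C + B)) := by
            refine norm_sum_le_of_le _ fun m _ => ?_
            rw [← smul_sub, norm_smul, Real.norm_of_nonneg (G.msgDist_nonneg _ _ _)]
            exact mul_le_mul_of_nonneg_left (ih _) (G.msgDist_nonneg _ _ _)
        _ = _ := by rw [← Finset.sum_mul, G.sum_msgDist, one_mul]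
  have hlim : Filter.Tendsto (fun k : ℕ => δ ^ k * (C + B)) Filter.atTop (nhds 0) := by
    simpa using (tendsto_pow_atTop_nhds_zero_of_lt_one hδ.1.le hδ.2).mul_const (C + B)
  have := ge_of_tendsto' hlim fun k => key k h
  exact sub_eq_zero.mp (norm_le_zero_iff.mp this)

end Dynamics

end PrivateMonitoringGame

end RepeatedGame

/-! ### Self-generation and patient players -/

namespace RepeatedGame

theorem valueDist_eq_sum_mul {n : ℕ} {N : Type*} [Fintype N] (q : N → ℝ)
    (w : N → EuclideanSpace ℝ (Fin n)) (y : EuclideanSpace ℝ (Fin n)) :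
    valueDist q w y = ∑ m, Set.indicator {y} 1 (w m) * q m := by
  classical
  simp [valueDist, Finset.sum_filter, Set.indicator_apply]

namespace PrivateMonitoringGame

variable {n : ℕ} {A S M : Fin n → Type*}
  [∀ i, Fintype (A i)] [∀ i, Fintype (S i)] [∀ i, Fintype (M i)]
  [∀ i, DecidableEq (S i)] [∀ i, DecidableEq (M i)]

/-- A bounded set is self-generating if each of its points is decomposed by enforcing payments that
keep the continuation payoffs in the set. -/
theorem subset_equilibriumPayoffs (G : PrivateMonitoringGame A S M) {η δ : ℝ}
    (hδ : δ ∈ Set.Ioo (0 : ℝ) 1) {W : Set (EuclideanSpace ℝ (Fin n))}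
    (hW : Bornology.IsBounded W)
    (h : ∀ v ∈ W, ∃ a ρ x, G.Enforces η a ρ x ∧ ∑ m, G.msgDist a ρ m • x m = 0 ∧
      ∀ m, v + ((1 - δ) / δ) • (v - G.g a + x m) ∈ W) :
    W ⊆ G.equilibriumPayoffs η δ := by
  intro v₀ hv₀
  obtain ⟨a₀, ρ₀, -⟩ := h v₀ hv₀
  have : Nonempty (∀ i, A i) := ⟨a₀⟩
  have : Nonempty (∀ i, S i → M i) := ⟨ρ₀⟩
  choose! a ρ x henf hzero hnext using h
  obtain ⟨B, hB⟩ := hW.exists_norm_le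
  have hδ0 : δ ≠ 0 := hδ.1.ne'
  have hδ1 : 1 - δ ≠ 0 := by linarith [hδ.2]
  let next : EuclideanSpace ℝ (Fin n) → (∀ i, M i) → EuclideanSpace ℝ (Fin n) :=
    fun v m => v + ((1 - δ) / δ) • (v - G.g (a v) + x v m)
  let w : List (∀ i, M i) → EuclideanSpace ℝ (Fin n) := fun h => h.foldl next v₀
  have hw_append : ∀ h m, w (h ++ [m]) = next (w h) m := fun h m => by simp [w]
  have hwW : ∀ h, w h ∈ W := by
    intro h
    induction h using List.reverseRecOn with
    | nil => exact hv₀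
    | append_singleton h m ih => rw [hw_append]; exact hnext _ ih m
  -- The promised payoff `w h` serves as the public state of an automaton.
  let σ : ∀ i, PublicStrategy A S M i := fun i =>
    { act := fun h => a (w h) i
      msg := fun h _ => ρ (w h) i }
  have hact : ∀ h, actAt σ h = a (w h) := fun _ => rfl
  have hmsg : ∀ h, msgAt σ h = ρ (w h) := fun _ => rfl
  have hcont : ∀ h, G.contPayoff δ σ h = w h := by
    refine G.contPayoff_eq_of_recursion σ hδ w (fun h => hB _ (hwW h)) fun h => ?_
    have h1 : ∑ m, G.msgDist (a (w h)) (ρ (w h)) m • w (h ++ [m])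
        = w h + ((1 - δ) / δ) • (w h - G.g (a (w h))) := by
      have h2 : ∀ m, G.msgDist (a (w h)) (ρ (w h)) m • w (h ++ [m])
          = G.msgDist (a (w h)) (ρ (w h)) m • (w h + ((1 - δ) / δ) • (w h - G.g (a (w h))))
            + ((1 - δ) / δ) • G.msgDist (a (w h)) (ρ (w h)) m • x (w h) m := fun m => by
        rw [hw_append]
        simp only [next, smul_add, smul_sub, smul_smul]
        rw [mul_comm ((1 - δ) / δ) (G.msgDist (a (w h)) (ρ (w h)) m)]
        abel
      simp only [h2, Finset.sum_add_distrib]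
      rw [← Finset.sum_smul, ← Finset.smul_sum, G.sum_msgDist, hzero _ (hwW h), one_smul,
        smul_zero, add_zero]
    rw [hact, hmsg, h1, smul_add, smul_smul, mul_div_cancel₀ _ hδ0, smul_sub]
    rw [sub_smul, sub_smul, one_smul, one_smul]
    abel
  refine ⟨σ, fun h i d hnt => ?_, (hcont []).symm⟩
  have hsum : ∀ q : (∀ i, M i) → ℝ, ∑ m, q m = 1 →
      δ / (1 - δ) * ∑ m, w (h ++ [m]) i * q m
        = δ / (1 - δ) * w h i + (w h i - G.g (a (w h)) i) + ∑ m, x (w h) m i * q m := by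
    intro q hq
    have h1 : ∀ m, w (h ++ [m]) i * q m
        = (w h i + (1 - δ) / δ * (w h i - G.g (a (w h)) i)) * q m
          + (1 - δ) / δ * (x (w h) m i * q m) := fun m => by
      rw [hw_append]
      simp only [next, PiLp.add_apply, PiLp.smul_apply, PiLp.sub_apply, smul_eq_mul]
      ring
    simp only [h1, Finset.sum_add_distrib]
    rw [← Finset.mul_sum, ← Finset.mul_sum, hq]
    field_simp
  simp only [IsNontrivialDeviation, hcont, hact, hmsg] at hnt ⊢
  rw [hsum _ (G.sum_devDist _ _ _ _), hsum _ (G.sum_msgDist _ _)]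
  rcases henf _ (hwW h) i d with hic | ⟨hd, htriv⟩
  · linarith
  · exfalso
    rcases hnt with hne | hne
    · exact hne hd
    · refine hne (funext fun y => ?_)
      rw [valueDist_eq_sum_mul, valueDist_eq_sum_mul]
      simp only [hw_append]
      exact htriv fun z => Set.indicator {y} 1 (w h + ((1 - δ) / δ) • (w h - G.g (a (w h)) + z))

section Decomposition

open Filter Topology
open scoped Pointwise

/-- Pointwise decomposability into the interior of a compact convex set is uniform. -/
theorem exists_uniform_decomposition (G : PrivateMonitoringGame A S M) {η : ℝ}
    {W : Set (EuclideanSpace ℝ (Fin n))} (hWk : IsCompact W) (hWc : Convex ℝ W)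
    (h : ∀ v ∈ W, ∃ a ρ x, G.Enforces η a ρ x ∧ ∑ m, G.msgDist a ρ m • x m = 0 ∧
      ∃ κ : ℝ, 0 < κ ∧ ∀ m, v + κ • (v - G.g a + x m) ∈ interior W) :
    ∃ κ₀ : ℝ, 0 < κ₀ ∧ ∀ v ∈ W, ∀ κ ∈ Set.Icc 0 κ₀, ∃ a ρ x, G.Enforces η a ρ x ∧
      ∑ m, G.msgDist a ρ m • x m = 0 ∧ ∀ m, v + κ • (v - G.g a + x m) ∈ W := by
  suffices h' : ∃ κ₀ : ℝ, 0 < κ₀ ∧ ∀ v ∈ W, v ∈ W → ∀ κ ∈ Set.Icc 0 κ₀, ∃ a ρ x,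
      G.Enforces η a ρ x ∧ ∑ m, G.msgDist a ρ m • x m = 0 ∧
        ∀ m, v + κ • (v - G.g a + x m) ∈ W by
    obtain ⟨κ₀, h0, h1⟩ := h'
    exact ⟨κ₀, h0, fun v hv => h1 v hv hv⟩
  refine hWk.induction_on (p := fun s => ∃ κ₀ : ℝ, 0 < κ₀ ∧ ∀ v ∈ s, v ∈ W → ∀ κ ∈ Set.Icc 0 κ₀,
    ∃ a ρ x, G.Enforces η a ρ x ∧ ∑ m, G.msgDist a ρ m • x m = 0 ∧
        ∀ m, v + κ • (v - G.g a + x m) ∈ W) ?_ ?_ ?_ ?_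
  · exact ⟨1, one_pos, fun v hv => hv.elim⟩
  · rintro s t hst ⟨κ₀, h0, h1⟩
    exact ⟨κ₀, h0, fun v hv => h1 v (hst hv)⟩
  · rintro s t ⟨κ₁, h0, h1⟩ ⟨κ₂, h0', h1'⟩
    refine ⟨min κ₁ κ₂, lt_min h0 h0', fun v hv hvW κ hκ => ?_⟩
    rcases hv with hv | hv
    · exact h1 v hv hvW κ ⟨hκ.1, hκ.2.trans (min_le_left _ _)⟩
    · exact h1' v hv hvW κ ⟨hκ.1, hκ.2.trans (min_le_right _ _)⟩
  · intro v hv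
    obtain ⟨a, ρ, x, hx, hx0, κ₁, hκ₁, hint⟩ := h v hv
    -- The same `a`, `ρ`, `x` and step `κ₁` work near `v` since the interior is open; smaller steps
    -- follow by convexity.
    have hev : ∀ᶠ v' in 𝓝 v, ∀ m, v' + κ₁ • (v' - G.g a + x m) ∈ interior W := by
      refine eventually_all.mpr fun m => ?_
      have hcts : Continuous fun v' => v' + κ₁ • (v' - G.g a + x m) := by fun_prop
      exact hcts.continuousAt.eventually (isOpen_interior.mem_nhds (hint m))
    refine ⟨_, mem_nhdsWithin_of_mem_nhds hev, κ₁, hκ₁, fun v' hv' hv'W κ hκ =>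
      ⟨a, ρ, x, hx, hx0, fun m => ?_⟩⟩
    have h1 := hWc.add_smul_sub_mem hv'W (interior_subset (hv' m))
      (t := κ / κ₁) ⟨div_nonneg hκ.1 hκ₁.le, (div_le_one hκ₁).mpr hκ.2⟩
    rwa [add_sub_cancel_left, smul_smul, div_mul_cancel₀ _ hκ₁.ne'] at h1

/-- Rounded sets in the interior of `V*(G)` are equilibrium payoff sets of patient players if every
direction is enforceable. -/
theorem exists_discount_subset_equilibriumPayoffs (G : PrivateMonitoringGame A S M) {η : ℝ}
    [NeZero n] {K : Set (EuclideanSpace ℝ (Fin n))} {r : ℝ} (hK : IsCompact K) (hKc : Convex ℝ K)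
    (h : ∀ v ∈ K + Metric.closedBall 0 r, ∀ l : EuclideanSpace ℝ (Fin n), l ≠ 0 →
      ∃ a ρ x, G.Enforces η a ρ x ∧ ∑ m, G.msgDist a ρ m • x m = 0 ∧
        ∀ m, ⟪l, v - G.g a + x m⟫ < 0) (hr : 0 < r) :
    ∃ δ₀ ∈ Set.Ioo (0 : ℝ) 1, ∀ δ ∈ Set.Ioo δ₀ 1,
      K + Metric.closedBall 0 r ⊆ G.equilibriumPayoffs η δ := by
  have hWk : IsCompact (K + Metric.closedBall (0 : EuclideanSpace ℝ (Fin n)) r) :=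
    hK.add (isCompact_closedBall _ _)
  obtain ⟨κ₀, hκ₀, hdec⟩ := G.exists_uniform_decomposition (η := η) hWk
      (hKc.add (convex_closedBall _ _)) (by
    intro v hv
    obtain ⟨k, hk, b, hb, rfl⟩ := id hv
    rw [mem_closedBall_zero_iff] at hb
    -- The direction is `b` whether or not `k + b` is a boundary point; for `b = 0` any nonzero
    -- vector serves.
    have hl : ∃ l : EuclideanSpace ℝ (Fin n), l ≠ 0 ∧ (‖b‖ < r ∨ l = b) := by
      by_cases hb0 : b = 0
      · obtain ⟨l, hl⟩ := exists_ne (0 : EuclideanSpace ℝ (Fin n))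
        exact ⟨l, hl, Or.inl (by simpa [hb0] using hr)⟩
      · exact ⟨b, hb0, Or.inr rfl⟩
    obtain ⟨l, hl0, hl⟩ := hl
    obtain ⟨a, ρ, x, hx, hx0, hlx⟩ := h _ hv l hl0
    refine ⟨a, ρ, x, hx, hx0, ?_⟩
    have hev : ∀ᶠ t in 𝓝[>] (0 : ℝ), ∀ m, ‖b + t • (k + b - G.g a + x m)‖ < r :=
      eventually_all.mpr fun m => eventually_add_smul_mem_ball hb
        (hl.imp_right fun hlb => by have := hlx m; rwa [hlb] at this)
    obtain ⟨t, ht, ht0⟩ := (hev.and self_mem_nhdsWithin).exists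
    refine ⟨t, ht0, fun m => ball_subset_interior_add_closedBall hk ?_⟩
    rw [mem_ball_iff_norm, add_assoc, add_sub_cancel_left]
    exact ht m)
  -- This threshold is where `(1 - δ) / δ = κ₀`.
  refine ⟨1 / (1 + κ₀), ⟨by positivity, (div_lt_one (by positivity)).mpr (by linarith)⟩,
    fun δ hδ => ?_⟩
  have hδ0 : 0 < δ := lt_trans (by positivity) hδ.1
  have h1 := (div_lt_iff₀ (by positivity)).mp hδ.1
  refine G.subset_equilibriumPayoffs ⟨hδ0, hδ.2⟩ hWk.isBounded fun v hv => hdec v hv _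
    ⟨div_nonneg (by linarith [hδ.2]) hδ0.le, (div_le_iff₀ hδ0).mpr (by linarith)⟩

/-- A convex body is approximated from within its interior by rounded compact convex sets. -/
theorem exists_rounded_approximation {V : Set (EuclideanSpace ℝ (Fin n))} (hV : IsCompact V)
    (hVc : Convex ℝ V) (hint : (interior V).Nonempty) {ε : ℝ} (hε : 0 < ε) :
    ∃ (K : Set (EuclideanSpace ℝ (Fin n))) (r : ℝ), K.Nonempty ∧ IsCompact K ∧ Convex ℝ K ∧
      0 < r ∧ K + Metric.closedBall 0 r ⊆ interior V ∧
      Metric.hausdorffDist (K + Metric.closedBall 0 r) V ≤ ε := by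
  obtain ⟨c, hc⟩ := hint
  obtain ⟨s, hs, hball⟩ := Metric.isOpen_iff.mp isOpen_interior c hc
  obtain ⟨D, hD, hVD⟩ := hV.isBounded.subset_closedBall_lt 0 c
  -- Shrinking `V` towards `c` by the factor `1 - θ` moves points by at most `θ * D` and leaves room
  -- for a ball of radius `θ * (s / 2)`.
  set θ := min (1 / 2) (ε / D) with hθ
  have hθ0 : 0 < θ := lt_min (by norm_num) (by positivity)
  have hθ1 : θ ≤ 1 / 2 := min_le_left _ _
  have hθε : θ * D ≤ ε := (le_div_iff₀ hD).mp (min_le_right _ _)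
  have hsub : ((1 - θ) • V + {θ • c}) + Metric.closedBall 0 (θ * (s / 2)) ⊆ interior V := by
    rintro _ ⟨_, ⟨_, ⟨v, hv, rfl⟩, _, rfl, rfl⟩, b, hb, rfl⟩
    rw [mem_closedBall_zero_iff] at hb
    have h1 : c + θ⁻¹ • b ∈ interior V := hball (by
      rw [mem_ball_iff_norm, add_sub_cancel_left, norm_smul, norm_inv, Real.norm_of_nonneg hθ0.le,
        ← div_eq_inv_mul, div_lt_iff₀ hθ0]
      nlinarith)
    have h2 := hVc.combo_self_interior_mem_interior hv h1 (a := 1 - θ) (b := θ) (by linarith) hθ0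
      (by ring)
    rwa [smul_add, smul_smul, mul_inv_cancel₀ hθ0.ne', one_smul, ← add_assoc] at h2
  refine ⟨(1 - θ) • V + {θ • c}, θ * (s / 2),
    ⟨_, Set.add_mem_add (Set.smul_mem_smul_set (interior_subset hc)) rfl⟩,
    (hV.smul _).add isCompact_singleton, (hVc.smul _).add (convex_singleton _), by positivity,
    hsub, ?_⟩
  refine Metric.hausdorffDist_le_of_mem_dist hε.le
    (fun x hx => ⟨x, interior_subset (hsub hx), by simpa using hε.le⟩) fun v hv => ?_
  refine ⟨(1 - θ) • v + θ • c, ⟨_, Set.add_mem_add (Set.smul_mem_smul_set hv) rfl, 0,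
    by simp; positivity, by simp⟩, ?_⟩
  have h1 : v - ((1 - θ) • v + θ • c) = θ • (v - c) := by
    rw [sub_smul, one_smul, smul_sub]; abel
  rw [dist_eq_norm, h1, norm_smul, Real.norm_of_nonneg hθ0.le]
  refine le_trans (mul_le_mul_of_nonneg_left ?_ hθ0.le) hθε
  simpa [dist_eq_norm] using hVD hv

end Decomposition

/-- Without players every payoff profile is an equilibrium payoff profile. -/
theorem mem_equilibriumPayoffs_of_isEmpty [IsEmpty (Fin n)] (G : PrivateMonitoringGame A S M)
    (η δ : ℝ) (v : EuclideanSpace ℝ (Fin n)) : v ∈ G.equilibriumPayoffs η δ :=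
  ⟨fun i => isEmptyElim i, fun _ i => isEmptyElim i, Subsingleton.elim _ _⟩

end PrivateMonitoringGame

end RepeatedGame

theorem mainTheorem2 {n : ℕ} {A S M : Fin n → Type*}
    [∀ i, Fintype (A i)] [∀ i, Fintype (S i)] [∀ i, Fintype (M i)]
    [∀ i, DecidableEq (S i)] [∀ i, DecidableEq (M i)]
    (G : RepeatedGame.PrivateMonitoringGame A S M)
    (η : ℝ) (hη : 0 ≤ η)
    (hint : (interior G.feasibleIR).Nonempty)
    (best worst : Fin n → ∀ i, A i)
    (hbr : G.BestResponseProperty η best worst)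
    (hdet : ∀ a ∈ G.extremeProfiles, ∃ ρ : ∀ i, S i → M i,
      G.DetectableWith η a ρ ∧ G.IdentifiableWith η a ρ)
    (hstar : ∀ i, G.StarDetectable η i (best i) ∧ G.StarDetectable η i (worst i))
    (ε : ℝ) (hε : 0 < ε) :
    ∃ W : Set (EuclideanSpace ℝ (Fin n)),
      RepeatedGame.IsSmoothCompactConvex W ∧
      W ⊆ interior G.feasibleIR ∧
      Metric.hausdorffDist W G.feasibleIR ≤ ε ∧
      ∃ δ₀ ∈ Set.Ioo (0 : ℝ) 1, ∀ δ ∈ Set.Ioo δ₀ 1, W ⊆ G.equilibriumPayoffs η δ := by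
  open RepeatedGame PrivateMonitoringGame in
  obtain ⟨K, r, hne, hK, hKc, hr, hsub, hdist⟩ := exists_rounded_approximation
    G.isCompact_feasibleIR G.convex_feasibleIR hint hε
  refine ⟨_, isSmoothCompactConvex_add_closedBall hne hK hKc hr, hsub, hdist, ?_⟩
  -- Without players there is no nonzero direction, so this case is separate.
  rcases Nat.eq_zero_or_pos n with rfl | hn
  · exact ⟨1 / 2, by norm_num, fun δ _ v _ => G.mem_equilibriumPayoffs_of_isEmpty η δ v⟩
  · have : NeZero n := ⟨hn.ne'⟩
    exact G.exists_discount_subset_equilibriumPayoffs hK hKc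
      (fun v hv l hl => G.exists_enforces_direction hbr hdet hstar (hsub hv) hl) hr
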